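/- Let $\Lambda=\mathbb Z\,2\omega+\mathbb Z\,2\omega'$ be a lattice in $\mathbb C$ with invariants $g_2,g_3$, let $E_{g_2,g_3}$ be the elliptic curve $y^2=4x^3-g_2x-g_3$, parametrized by $(x,y)=(\wp(u),\wp'(u))$, so that $dx/y=du$, and let $\ell\ge1$ be an integer. Multi-valued functions on $E_{g_2,g_3}$ are written as functions of $u$. The Lamé equation is $\{(y\,d/dx)^2-[\ell(\ell+1)x+B]\}\Psi=0$. Let $\Gamma_\ell$ be its spectral curve $\nu^2=\mathsf L_\ell(B;g_2,g_3)$, where $\mathsf L_\ell$, of degree $2\ell+1$ in $B$, is the full Lamé spectral polynomial: the product of the monic Type-I polynomial and the three monic Type-II polynomials (one for each root $e_\gamma$ of $4x^3-g_2x-g_3$) whose roots, with multiplicity, are the $B$ for which there is a solution $C(x)$ or $D(x)y$, respectively $E(x)\sqrt{x-e_\gamma}$ or $F(x)y/\sqrt{x-e_\gamma}$, with $C,D,E,F$ polynomials. In particular $\mathsf L_1=B^3-\frac14g_2B-\frac14g_3$, so $(B,\nu)=(x_0,y_0/2)$ identifies $\Gamma_1$ with $E_{g_2,g_3}$. For a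 finite point $(x_0,y_0)$ of $E_{g_2,g_3}$ put $\Phi(x,y;x_0,y_0)=\exp\left[\frac12\int\frac{y+y_0}{x-x_0}\frac{dx}{y}\right]$, defined up to a constant factor. A Hermite–Krichever solution with parameters $(x_0,y_0),\kappa$ is a nonzero solution of the Lamé equation of the form $$\left[\mathcal A(x)+\mathcal B(x)\frac{y+y_0}{x-x_0}\right]\Phi(x,y;x_0,y_0)\,\exp\left[\kappa\int\frac{dx}{y}\right],\qquad \mathcal A,\mathcal B\ \text{polynomials}.$$ The crystal momentum of a function that is multiplied by $\xi$ under $u\mapsto u+2\omega$ is the additively multi-valued quantity $k$ with $\xi=\exp[ik(2\omega)]$; it is determined up to integer multiples of $\pi/\omega$. Let $k_1(B,\nu)$, for $(B,\nu)\in\Gamma_1$, be the crystal momentum of $\Phi(\cdot,\cdot;B,2\nu)$, which solves the Lamé equation with $\ell=1$. Let $B_\ell(B)$, $\hat\kappa_\ell(B)$ be rational functions of $B$ and $\nu_\ell(B,\nu)$ a rational function on $\Gamma_\ell$, and suppose that the Lamé equation is integrated in the framework of the Hermite–Krichever Ansatz by the maps $\pi_\ell:\Gamma_\ell\to\Gamma_1$,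 $(B,\nu)\mapsto(B_\ell,\nu_\ell)$, and $\kappa_\ell=\hat\kappa_\ell\nu$. That is, there is a finite set $S\subset\mathbb C$ such that for all finite $(B,\nu)\in\Gamma_\ell$ with $B\notin S$ the maps have no pole, $(B_\ell,\nu_\ell)\in\Gamma_1$, and the Lamé equation has a Hermite–Krichever solution with $(x_0,y_0)=(B_\ell,2\nu_\ell)$ and $\kappa=\hat\kappa_\ell\nu$. Then for all finite $(B,\nu)\in\Gamma_\ell$ with $B\notin S$, all these Hermite–Krichever solutions at $(B,\nu)$ have the same crystal momentum $k_\ell(B,\nu)$; its set of values is a single coset of $\frac{\pi}{\omega}\mathbb Z$, and $$k_\ell(B,\nu)=k_1\big(B_\ell(B),\nu_\ell(B,\nu)\big)-i\,\hat\kappa_\ell(B)\,\nu$$ as an equality of multi-valued quantities. Here the first term is the crystal momentum of the factor $\Phi$ and the second is a value of the crystal momentum of the exponential factor, while the factor containing $\mathcal A,\mathcal B$ is invariant under $u\mapsto u+2\omega$. -/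

import Mathlib

open Polynomial Complex

noncomputable section

namespace Lame

/-! ## Lamé spectral polynomials and the spectral curves

Polynomials in the energy parameter `B` are elements of `ℂ[X]`, the variable `X` being `B`. -/

/-- Downward solution of a four-term recurrence
`a j * c_j + b j * c_{j+1} + p j * c_{j+2} + q j * c_{j+3} = 0`,
started at the top index `n` by `c_n = 1` and `c_j = 0` for `j > n`.
After `t` steps the state is `(c_{n-t}, c_{n-t+1}, c_{n-t+2})`. -/
def descend (n : ℤ) (a : ℤ → ℂ) (b : ℤ → ℂ[X]) (p q : ℤ → ℂ) : ℕ → ℂ[X] × ℂ[X] × ℂ[X]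
  | 0 => (1, 0, 0)
  | t + 1 =>
    let j : ℤ := n - (t + 1)
    let s := descend n a b p q t
    (-(C (a j)⁻¹ * (b j * s.1 + C (p j) * s.2.1 + C (q j) * s.2.2)), s.1, s.2.1)

/-- The monic polynomial proportional to a given one. -/
def monicPart (p : ℂ[X]) : ℂ[X] := C p.leadingCoeff⁻¹ * p

/-- `c_{-1}`, for Lamé polynomials `C(x) = ∑ c_j x^j` (`ℓ` even, `deg C = ℓ / 2`). -/
def coeffC (ℓ : ℕ) (g₂ g₃ : ℂ) : ℂ[X] :=
  (descend ((ℓ / 2 : ℕ) : ℤ)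
    (fun j => (2 * j - ℓ) * (2 * j + ℓ + 1))
    (fun _ => -X)
    (fun j => -((j + 2) * (j + 3 / 2) * g₂))
    (fun j => -((j + 2) * (j + 3) * g₃)) (ℓ / 2 + 1)).1

/-- `d_{-1}`, for Lamé polynomials `D(x) y`, `D(x) = ∑ d_j x^j`
(`ℓ` odd, `deg D = (ℓ - 3) / 2 = (ℓ - 1) / 2 - 1`; for `ℓ = 1` this gives the conventional `1`). -/
def coeffD (ℓ : ℕ) (g₂ g₃ : ℂ) : ℂ[X] :=
  (descend (((ℓ - 1) / 2 : ℕ) - 1 : ℤ)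
    (fun j => (2 * j - ℓ + 3) * (2 * j + ℓ + 4))
    (fun _ => -X)
    (fun j => -((j + 2) * (j + 5 / 2) * g₂))
    (fun j => -((j + 2) * (j + 3) * g₃)) ((ℓ - 1) / 2)).1

/-- `e_{-1}`, for Lamé polynomials `E(x) √(x - e)`, `E(x) = ∑ e_j x^j`
(`ℓ` odd, `deg E = (ℓ - 1) / 2`). -/
def coeffE (ℓ : ℕ) (e g₂ g₃ : ℂ) : ℂ[X] :=
  (descend (((ℓ - 1) / 2 : ℕ) : ℤ)
    (fun j => (2 * j - ℓ + 1) * (2 * j + ℓ + 2))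
    (fun j => C ((4 * j + 5) * e) - X)
    (fun j => (-((j + 5 / 2) * g₂) + 4 * e ^ 2) * (j + 2))
    (fun j => -((j + 2) * (j + 3) * g₃)) ((ℓ - 1) / 2 + 1)).1

/-- `f_{-1}`, for Lamé polynomials `F(x) y / √(x - e)`, `F(x) = ∑ f_j x^j`
(`ℓ` even, `deg F = (ℓ - 2) / 2 = ℓ / 2 - 1`). -/
def coeffF (ℓ : ℕ) (e g₂ g₃ : ℂ) : ℂ[X] :=
  (descend ((ℓ / 2 : ℕ) - 1 : ℤ)
    (fun j => (2 * j - ℓ + 2) * (2 * j + ℓ + 3))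
    (fun j => C (-((4 * j + 7) * e)) - X)
    (fun j => (-((j + 3 / 2) * g₂) - 4 * e ^ 2) * (j + 2))
    (fun j => -((j + 2) * (j + 3) * g₃)) (ℓ / 2)).1

/-- Type-I Lamé spectral polynomial. -/
def spectralI (ℓ : ℕ) (g₂ g₃ : ℂ) : ℂ[X] :=
  monicPart (if Odd ℓ then coeffD ℓ g₂ g₃ else coeffC ℓ g₂ g₃)

/-- Type-II Lamé spectral polynomial associated with the branch point `e`. -/
def spectralII (ℓ : ℕ) (e g₂ g₃ : ℂ) : ℂ[X] :=
  monicPart (if Odd ℓ then coeffE ℓ e g₂ g₃ else coeffF ℓ e g₂ g₃)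

/-- The multiset `{e₁, e₂, e₃}` of roots of `4 x³ - g₂ x - g₃`. -/
def branchPoints (g₂ g₃ : ℂ) : Multiset ℂ := (C 4 * X ^ 3 - C g₂ * X - C g₃ : ℂ[X]).roots

/-- The full Lamé spectral polynomial, of degree `2 ℓ + 1`. -/
def spectralPoly (ℓ : ℕ) (g₂ g₃ : ℂ) : ℂ[X] :=
  spectralI ℓ g₂ g₃ * ((branchPoints g₂ g₃).map fun e => spectralII ℓ e g₂ g₃).prod

/-- The `ℓ`-th Lamé spectral curve without its point at infinity: the set of all `(B, ν)` with
`ν² = L_ℓ(B; g₂, g₃)`. -/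
def spectralCurve (ℓ : ℕ) (g₂ g₃ : ℂ) : Set (ℂ × ℂ) :=
  {P | P.2 ^ 2 = (spectralPoly ℓ g₂ g₃).eval P.1}

/-! ## The Lamé equation on the elliptic curve and its Hermite–Krichever solutions

`Λ : PeriodPair` has fundamental periods `2ω = Λ.ω₁`, `2ω' = Λ.ω₂`, and the elliptic curve
`y² = 4 x³ - g₂ x - g₃` with `g₂ = Λ.g₂`, `g₃ = Λ.g₃` is parametrized by `x = ℘(u)`, `y = ℘'(u)`.
Thus `dx / y = du` and `y d/dx = d/du`; the point at infinity corresponds to the lattice points, and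
(multiplicatively) multi-valued functions on the curve are written as functions of `u`: going once
around the fundamental loop is the translation `u ↦ u + 2ω`. -/

/-- The punctured `u`-plane: the complement of the period lattice. -/
def finitePart (Λ : PeriodPair) : Set ℂ := {u | u ∉ Λ.lattice}

/-- The points `u` of the plane where both `x` is finite and `x ≠ x₀`. -/
def offPoint (Λ : PeriodPair) (x₀ : ℂ) : Set ℂ := {u | u ∉ Λ.lattice ∧ Λ.weierstrassP u ≠ x₀}

/-- `Φ` is a branch of the fundamental multi-valued function
`Φ(x, y; x₀, y₀) = exp [½ ∫ ((y + y₀) / (x - x₀)) dx / y]`, which is defined up to a nonzero constant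
factor: a zero-free function whose logarithmic derivative with respect to `u` is
`½ (y + y₀) / (x - x₀)`. -/
def IsPhi (Λ : PeriodPair) (x₀ y₀ : ℂ) (Φ : ℂ → ℂ) : Prop :=
  ∀ u ∈ offPoint Λ x₀, Φ u ≠ 0 ∧
    HasDerivAt Φ
      (1 / 2 * ((Λ.derivWeierstrassP u + y₀) / (Λ.weierstrassP u - x₀)) * Φ u) u

/-- `Ψ` solves the integer-`ℓ` Lamé equation `{(y d/dx)² - [ℓ(ℓ+1) x + B]} Ψ = 0` on the punctured
curve. -/
def IsLameSolution (Λ : PeriodPair) (ℓ : ℕ) (B : ℂ) (Ψ : ℂ → ℂ) : Prop :=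
  DifferentiableOn ℂ Ψ (finitePart Λ) ∧
    ∀ u ∈ finitePart Λ, deriv (deriv Ψ) u = (ℓ * (ℓ + 1) * Λ.weierstrassP u + B) * Ψ u

/-- `Ψ` has the Hermite–Krichever form
`[𝒜(x) Φ + 2 ℬ(x) (y d/dx) Φ] exp [κ ∫ dx / y]`, where `Φ = Φ(·, ·; x₀, y₀)`. -/
def IsHKForm (Λ : PeriodPair) (x₀ y₀ κ : ℂ) (𝒜 ℬ : ℂ[X]) (Φ Ψ : ℂ → ℂ) : Prop :=
  IsPhi Λ x₀ y₀ Φ ∧ ∀ u ∈ offPoint Λ x₀,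
    Ψ u = (𝒜.eval (Λ.weierstrassP u) * Φ u + 2 * ℬ.eval (Λ.weierstrassP u) * deriv Φ u) *
      exp (κ * u)

/-- The factor `𝒜(x) + ℬ(x) (y + y₀) / (x - x₀)` of a Hermite–Krichever solution. -/
def hkFactor (Λ : PeriodPair) (x₀ y₀ : ℂ) (𝒜 ℬ : ℂ[X]) (u : ℂ) : ℂ :=
  𝒜.eval (Λ.weierstrassP u) +
    ℬ.eval (Λ.weierstrassP u) * ((Λ.derivWeierstrassP u + y₀) / (Λ.weierstrassP u - x₀))

/-- `Ψ` is a (nonzero) Hermite–Krichever solution of the Lamé equation with energy parameter `B`,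
belonging to the point `(x₀, y₀)` and the exponent `κ`. -/
def IsHKSolution (Λ : PeriodPair) (ℓ : ℕ) (B x₀ y₀ κ : ℂ) (Ψ : ℂ → ℂ) : Prop :=
  IsLameSolution Λ ℓ B Ψ ∧ (∃ u ∈ finitePart Λ, Ψ u ≠ 0) ∧
    ∃ (𝒜 ℬ : ℂ[X]) (Φ : ℂ → ℂ), IsHKForm Λ x₀ y₀ κ 𝒜 ℬ Φ Ψ

/-! ## Crystal momentum -/

/-- `k` is a value of the crystal momentum of the function `F` on the (translation-invariant) domain
`D`: `F` is multiplied by `ξ = exp [i k (2ω)]` under `u ↦ u + 2ω`. -/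
def HasCrystalMomentum (Λ : PeriodPair) (D : Set ℂ) (F : ℂ → ℂ) (k : ℂ) : Prop :=
  ∀ u ∈ D, F (u + Λ.ω₁) = exp (I * k * Λ.ω₁) * F u

/-- The set of values at `P = (B, ν)` on the first spectral curve of the (additively multi-valued)
`ℓ = 1` crystal momentum `k₁`: the crystal momentum of the `ℓ = 1` solution `Φ(·, ·; B, 2ν)`. -/
def crystalMomentumOne (Λ : PeriodPair) (P : ℂ × ℂ) : Set ℂ :=
  {k | ∃ Φ : ℂ → ℂ, IsPhi Λ P.1 (2 * P.2) Φ ∧ HasCrystalMomentum Λ (offPoint Λ P.1) Φ k}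

/-- Candidate maps for the Ansatz, as rational functions on the `ℓ`-th spectral curve:
`B_ℓ` and `κ̂_ℓ` are rational in `B`, and `ν_ℓ = ν₀(B) + ν₁(B) ν` is an arbitrary rational
function of `(B, ν)` on the curve. -/
structure AnsatzMaps where
  energy : RatFunc ℂ
  nuEven : RatFunc ℂ
  nuOdd : RatFunc ℂ
  kappaHat : RatFunc ℂ

/-- The map `π_ℓ : (B, ν) ↦ (B_ℓ(B), ν_ℓ(B, ν))`. -/
def AnsatzMaps.proj (M : AnsatzMaps) (P : ℂ × ℂ) : ℂ × ℂ :=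
  (M.energy.eval (RingHom.id ℂ) P.1,
    M.nuEven.eval (RingHom.id ℂ) P.1 + M.nuOdd.eval (RingHom.id ℂ) P.1 * P.2)

/-- The map `κ_ℓ : (B, ν) ↦ κ̂_ℓ(B) ν`. -/
def AnsatzMaps.kappa (M : AnsatzMaps) (P : ℂ × ℂ) : ℂ :=
  M.kappaHat.eval (RingHom.id ℂ) P.1 * P.2

/-- `B` is a pole of none of the rational functions that make up the maps. -/
def AnsatzMaps.RegularAt (M : AnsatzMaps) (B : ℂ) : Prop :=
  M.energy.denom.eval B ≠ 0 ∧ M.nuEven.denom.eval B ≠ 0 ∧ M.nuOdd.denom.eval B ≠ 0 ∧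
    M.kappaHat.denom.eval B ≠ 0

/-- `Ψ` is a Hermite–Krichever solution that the maps `M` attach to the point `P = (B, ν)`: it has
`(x₀, y₀) = (B_ℓ, 2 ν_ℓ)` (the identification of the first spectral curve with the elliptic curve)
and `κ = κ̂_ℓ ν`. -/
def AnsatzMaps.IsSolutionAt (M : AnsatzMaps) (Λ : PeriodPair) (ℓ : ℕ) (P : ℂ × ℂ)
    (Ψ : ℂ → ℂ) : Prop :=
  IsHKSolution Λ ℓ P.1 (M.proj P).1 (2 * (M.proj P).2) (M.kappa P) Ψ

/-- The integer-`ℓ` Lamé equation is integrated in the framework of the Hermite–Krichever Ansatz by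
the maps `M`: for all points of the `ℓ`-th spectral curve with `B` outside a finite set `S`, the maps
are finite, take the point into the first spectral curve, and there is a Hermite–Krichever solution
with the parameters that the maps prescribe. -/
structure AnsatzMaps.Integrates (M : AnsatzMaps) (Λ : PeriodPair) (ℓ : ℕ) (S : Set ℂ) : Prop where
  finite : S.Finite
  regular : ∀ B, B ∉ S → M.RegularAt B
  mapsTo : ∀ P ∈ spectralCurve ℓ Λ.g₂ Λ.g₃, P.1 ∉ S → M.proj P ∈ spectralCurve 1 Λ.g₂ Λ.g₃
  solvable : ∀ P ∈ spectralCurve ℓ Λ.g₂ Λ.g₃, P.1 ∉ S → ∃ Ψ, M.IsSolutionAt Λ ℓ P Ψ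

/-- The dispersion relation of the Hermite–Krichever solutions: the set of values at `P = (B, ν)` of
their (additively multi-valued) crystal momentum `k_ℓ`. -/
def AnsatzMaps.crystalMomentum (M : AnsatzMaps) (Λ : PeriodPair) (ℓ : ℕ) (P : ℂ × ℂ) : Set ℂ :=
  {k | ∃ Ψ, M.IsSolutionAt Λ ℓ P Ψ ∧ HasCrystalMomentum Λ (finitePart Λ) Ψ k}

end Lame

end

/-!
On `offPoint Λ x₀` the conditions defining a branch of `Φ` form the first-order linear equation
`Φ' = ½ (y + y₀) / (x - x₀) · Φ`, whose coefficient is elliptic. The set `offPoint Λ x₀` is the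
complement of a countable set in the plane, since `℘` is not constant, so it is connected
(`isPreconnected_offPoint`) and two branches differ by a constant factor (`IsPhi.exists_eq_mul`).
A translate of a branch by `2ω` is again a branch, hence `Φ` has a multiplier `ξ ≠ 0`, the same for
all branches, and the solutions `k` of `exp (i k 2ω) = ξ` form one coset of `(π / ω) ℤ`.

A Hermite–Krichever solution is, off the points over `x₀`, the product of an elliptic function, of
`Φ`, and of `exp (κ u)`. So it has multiplier `ξ · exp (κ 2ω)` there, and by continuity at every
finite point, because `offPoint Λ x₀` is dense (`IsHKSolution.hasCrystalMomentum_iff`). A branch `Φ`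
exists because it is part of the Hermite–Krichever solution that the Ansatz provides.
-/

namespace Lame

variable {Λ : PeriodPair} {x₀ y₀ κ : ℂ}

/-! ### The punctured plane -/

lemma omega_ne_zero (Λ : PeriodPair) : Λ.ω₁ ≠ 0 := Λ.indep.ne_zero 0

lemma weierstrassP_add_omega (Λ : PeriodPair) (u : ℂ) :
    Λ.weierstrassP (u + Λ.ω₁) = Λ.weierstrassP u :=
  Λ.weierstrassP_add_coe u ⟨Λ.ω₁, Λ.ω₁_mem_lattice⟩

lemma derivWeierstrassP_add_omega (Λ : PeriodPair) (u : ℂ) :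
    Λ.derivWeierstrassP (u + Λ.ω₁) = Λ.derivWeierstrassP u :=
  Λ.derivWeierstrassP_add_coe u ⟨Λ.ω₁, Λ.ω₁_mem_lattice⟩

lemma add_omega_mem_finitePart {u : ℂ} (hu : u ∈ finitePart Λ) : u + Λ.ω₁ ∈ finitePart Λ :=
  fun h => hu ((Submodule.add_mem_iff_left _ Λ.ω₁_mem_lattice).1 h)

lemma add_omega_mem_offPoint {u : ℂ} (hu : u ∈ offPoint Λ x₀) : u + Λ.ω₁ ∈ offPoint Λ x₀ :=
  ⟨add_omega_mem_finitePart hu.1, by rw [weierstrassP_add_omega]; exact hu.2⟩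

lemma offPoint_subset_finitePart (Λ : PeriodPair) (x₀ : ℂ) : offPoint Λ x₀ ⊆ finitePart Λ :=
  fun _ hu => hu.1

lemma isOpen_finitePart (Λ : PeriodPair) : IsOpen (finitePart Λ) :=
  Λ.isClosed_lattice.isOpen_compl

lemma isOpen_offPoint (Λ : PeriodPair) (x₀ : ℂ) : IsOpen (offPoint Λ x₀) :=
  Λ.differentiableOn_weierstrassP.continuousOn.isOpen_inter_preimage (isOpen_finitePart Λ)
    isOpen_compl_singleton

lemma countable_lattice (Λ : PeriodPair) : (Λ.lattice : Set ℂ).Countable :=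
  Set.countable_coe_iff.1 (countable_of_Lindelof_of_discrete (X := Λ.lattice))

lemma isConnected_finitePart (Λ : PeriodPair) : IsConnected (finitePart Λ) :=
  (countable_lattice Λ).isConnected_compl_of_one_lt_rank
    (rank_real_complex ▸ Nat.one_lt_ofNat)

/-- `℘` is not constant: it has a pole at `0`. -/
lemma offPoint_nonempty (Λ : PeriodPair) (x₀ : ℂ) : (offPoint Λ x₀).Nonempty := by
  by_contra h
  have hconst : ∀ u ∉ Λ.lattice, Λ.weierstrassP u = x₀ := fun u hu =>
    by_contra fun hne => h ⟨u, hu, hne⟩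
  have hev : Λ.weierstrassP =ᶠ[nhdsWithin 0 {0}ᶜ] fun _ => x₀ := by
    filter_upwards [self_mem_nhdsWithin,
      mem_nhdsWithin_of_mem_nhds (Λ.compl_lattice_sdiff_singleton_mem_nhds 0)] with u hu hu'
    exact hconst u fun hL => hu' ⟨hL, hu⟩
  have horder := Λ.order_weierstrassP 0 Λ.lattice.zero_mem
  rw [meromorphicOrderAt_congr hev] at horder
  have hnonneg := (analyticAt_const (𝕜 := ℂ) (v := x₀) (x := (0 : ℂ))).meromorphicOrderAt_nonneg
  rw [horder] at hnonneg
  exact absurd hnonneg (by decide)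

lemma countable_compl_offPoint (Λ : PeriodPair) (x₀ : ℂ) : (offPoint Λ x₀)ᶜ.Countable := by
  obtain ⟨u, hu⟩ := offPoint_nonempty Λ x₀
  have han : AnalyticOnNhd ℂ (fun z => Λ.weierstrassP z - x₀) (finitePart Λ) :=
    Λ.analyticOnNhd_weierstrassP.sub analyticOnNhd_const
  have hcod := han.preimage_zero_mem_codiscreteWithin (sub_ne_zero.2 hu.2) hu.1
    (isConnected_finitePart Λ)
  rw [Set.preimage_compl] at hcod
  have hdisc := isDiscrete_of_codiscreteWithin hcod
  have hfib := (HereditarilyLindelofSpace.isLindelof _).countable_of_isDiscrete hdisc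
  refine ((countable_lattice Λ).union hfib).mono fun z hz => ?_
  by_cases hzL : z ∈ Λ.lattice
  · exact Or.inl hzL
  · refine Or.inr ⟨?_, hzL⟩
    by_contra hne
    exact hz ⟨hzL, fun h => hne (sub_eq_zero.2 h)⟩

lemma isPreconnected_offPoint (Λ : PeriodPair) (x₀ : ℂ) : IsPreconnected (offPoint Λ x₀) := by
  have h := (countable_compl_offPoint Λ x₀).isConnected_compl_of_one_lt_rank
    (rank_real_complex ▸ Nat.one_lt_ofNat)
  rw [compl_compl] at h
  exact h.isPreconnected

lemma dense_offPoint (Λ : PeriodPair) (x₀ : ℂ) : Dense (offPoint Λ x₀) := by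
  simpa using (countable_compl_offPoint Λ x₀).dense_compl ℝ

/-! ### Values of the crystal momentum -/

lemma exp_mul_omega_eq_iff (Λ : PeriodPair) (k k' : ℂ) :
    exp (I * k' * Λ.ω₁) = exp (I * k * Λ.ω₁) ↔ ∃ n : ℤ, k + n * (2 * Real.pi / Λ.ω₁) = k' := by
  have hω := omega_ne_zero Λ
  rw [exp_eq_exp_iff_exists_int]
  refine exists_congr fun n => ?_
  constructor
  · intro h
    have : I * Λ.ω₁ * (k + n * (2 * Real.pi / Λ.ω₁)) = I * Λ.ω₁ * k' := by
      linear_combination I * n * div_mul_cancel₀ (2 * (Real.pi : ℂ)) hω - h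
    exact mul_left_cancel₀ (mul_ne_zero I_ne_zero hω) this
  · rintro rfl
    field_simp

/-- Two crystal momenta of a function that does not vanish identically give the same multiplier. -/
lemma HasCrystalMomentum.iff_exp_eq {D : Set ℂ} {F : ℂ → ℂ} {k : ℂ}
    (h : HasCrystalMomentum Λ D F k) (hF : ∃ u ∈ D, F u ≠ 0) (k' : ℂ) :
    HasCrystalMomentum Λ D F k' ↔ exp (I * k' * Λ.ω₁) = exp (I * k * Λ.ω₁) := by
  constructor
  · intro h'
    obtain ⟨u, hu, hne⟩ := hF
    exact mul_right_cancel₀ hne ((h' u hu).symm.trans (h u hu))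
  · intro he u hu
    rw [he, h u hu]

lemma hasCrystalMomentum_exp (Λ : PeriodPair) (κ : ℂ) :
    HasCrystalMomentum Λ Set.univ (fun u => exp (κ * u)) (-(I * κ)) := by
  intro u _
  dsimp only
  rw [← exp_add]
  congr 1
  linear_combination (κ * Λ.ω₁) * I_mul_I

lemma hasCrystalMomentum_hkFactor (Λ : PeriodPair) (x₀ y₀ : ℂ) (𝒜 ℬ : ℂ[X]) (D : Set ℂ) :
    HasCrystalMomentum Λ D (hkFactor Λ x₀ y₀ 𝒜 ℬ) 0 := by
  intro u _
  simp [hkFactor, weierstrassP_add_omega, derivWeierstrassP_add_omega]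

/-! ### Branches of `Φ` -/

lemma IsPhi.exists_eq_mul {Φ Φ' : ℂ → ℂ} (h : IsPhi Λ x₀ y₀ Φ) (h' : IsPhi Λ x₀ y₀ Φ') :
    ∃ c : ℂ, c ≠ 0 ∧ ∀ u ∈ offPoint Λ x₀, Φ' u = c * Φ u := by
  have hderiv : ∀ u ∈ offPoint Λ x₀, HasDerivAt (fun z => Φ' z / Φ z) 0 u := by
    intro u hu
    refine ((h' u hu).2.div (h u hu).2 (h u hu).1).congr_deriv ?_
    rw [div_eq_zero_iff]
    left
    ring
  obtain ⟨c, hc⟩ := (isOpen_offPoint Λ x₀).exists_is_const_of_deriv_eq_zero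
    (isPreconnected_offPoint Λ x₀)
    (fun u hu => (hderiv u hu).differentiableAt.differentiableWithinAt)
    (fun u hu => (hderiv u hu).deriv)
  refine ⟨c, ?_, fun u hu => (div_eq_iff (h u hu).1).1 (hc u hu)⟩
  obtain ⟨u, hu⟩ := offPoint_nonempty Λ x₀
  rw [← hc u hu]
  exact div_ne_zero (h' u hu).1 (h u hu).1

lemma IsPhi.comp_add_omega {Φ : ℂ → ℂ} (h : IsPhi Λ x₀ y₀ Φ) :
    IsPhi Λ x₀ y₀ (fun u => Φ (u + Λ.ω₁)) := by
  intro u hu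
  have h' := h _ (add_omega_mem_offPoint hu)
  refine ⟨h'.1, ?_⟩
  have hd := h'.2.comp_add_const u Λ.ω₁
  rwa [weierstrassP_add_omega, derivWeierstrassP_add_omega] at hd

lemma IsPhi.exists_ne_zero {Φ : ℂ → ℂ} (h : IsPhi Λ x₀ y₀ Φ) : ∃ u ∈ offPoint Λ x₀, Φ u ≠ 0 :=
  (offPoint_nonempty Λ x₀).imp fun u hu => ⟨hu, (h u hu).1⟩

lemma IsPhi.exists_hasCrystalMomentum {Φ : ℂ → ℂ} (h : IsPhi Λ x₀ y₀ Φ) :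
    ∃ k, HasCrystalMomentum Λ (offPoint Λ x₀) Φ k := by
  obtain ⟨c, hc, hmul⟩ := h.exists_eq_mul h.comp_add_omega
  refine ⟨log c / (I * Λ.ω₁), fun u hu => ?_⟩
  have hω := omega_ne_zero Λ
  have hexp : I * (log c / (I * Λ.ω₁)) * Λ.ω₁ = log c := by
    field_simp [I_ne_zero]
  rw [hexp, exp_log hc]
  exact hmul u hu

lemma IsPhi.hasCrystalMomentum_of_isPhi {Φ Φ' : ℂ → ℂ} (h : IsPhi Λ x₀ y₀ Φ)
    (h' : IsPhi Λ x₀ y₀ Φ') {k : ℂ} (hk : HasCrystalMomentum Λ (offPoint Λ x₀) Φ k) :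
    HasCrystalMomentum Λ (offPoint Λ x₀) Φ' k := by
  obtain ⟨c, -, hmul⟩ := h.exists_eq_mul h'
  intro u hu
  rw [hmul _ (add_omega_mem_offPoint hu), hmul u hu, hk u hu]
  ring

/-- The `ℓ = 1` crystal momentum can be read off from any single branch of `Φ`. -/
lemma IsPhi.hasCrystalMomentum_iff_mem {P : ℂ × ℂ} {Φ : ℂ → ℂ} (h : IsPhi Λ P.1 (2 * P.2) Φ)
    (k : ℂ) : HasCrystalMomentum Λ (offPoint Λ P.1) Φ k ↔ k ∈ crystalMomentumOne Λ P :=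
  ⟨fun hk => ⟨Φ, h, hk⟩, fun ⟨_, h', hk⟩ => h'.hasCrystalMomentum_of_isPhi h hk⟩

/-! ### Hermite–Krichever solutions -/

lemma IsHKForm.eq_hkFactor_mul {𝒜 ℬ : ℂ[X]} {Φ Ψ : ℂ → ℂ} (h : IsHKForm Λ x₀ y₀ κ 𝒜 ℬ Φ Ψ)
    {u : ℂ} (hu : u ∈ offPoint Λ x₀) :
    Ψ u = hkFactor Λ x₀ y₀ 𝒜 ℬ u * Φ u * exp (κ * u) := by
  rw [h.2 u hu, (h.1 u hu).2.deriv, hkFactor]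
  ring

lemma IsHKSolution.exists_isPhi {ℓ : ℕ} {B : ℂ} {Ψ : ℂ → ℂ}
    (h : IsHKSolution Λ ℓ B x₀ y₀ κ Ψ) : ∃ Φ, IsPhi Λ x₀ y₀ Φ :=
  let ⟨_, _, _, _, Φ, hform⟩ := h
  ⟨Φ, hform.1⟩

lemma IsHKSolution.hasCrystalMomentum_sub {ℓ : ℕ} {B k : ℂ} {Φ Ψ : ℂ → ℂ}
    (h : IsHKSolution Λ ℓ B x₀ y₀ κ Ψ) (hΦ : IsPhi Λ x₀ y₀ Φ)
    (hk : HasCrystalMomentum Λ (offPoint Λ x₀) Φ k) :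
    HasCrystalMomentum Λ (finitePart Λ) Ψ (k - I * κ) := by
  obtain ⟨hL, -, 𝒜, ℬ, Φ₁, hform⟩ := h
  have hk₁ := hΦ.hasCrystalMomentum_of_isPhi hform.1 hk
  have hcont := hL.1.continuousOn
  have hoff : Set.EqOn (fun u => Ψ (u + Λ.ω₁)) (fun u => exp (I * (k - I * κ) * Λ.ω₁) * Ψ u)
      (offPoint Λ x₀) := by
    intro u hu
    have hexp := hasCrystalMomentum_exp Λ κ u trivial
    have hfac := hasCrystalMomentum_hkFactor Λ x₀ y₀ 𝒜 ℬ Set.univ u trivial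
    have hsplit : I * (k - I * κ) * Λ.ω₁ = I * k * Λ.ω₁ + I * (-(I * κ)) * Λ.ω₁ := by ring
    dsimp only at hexp ⊢
    rw [mul_zero, zero_mul, exp_zero, one_mul] at hfac
    rw [hform.eq_hkFactor_mul (add_omega_mem_offPoint hu), hform.eq_hkFactor_mul hu, hexp, hfac,
      hk₁ u hu, hsplit, exp_add]
    ring
  -- `Ψ` is continuous at the points over `x₀`, so the relation extends to them by density.
  exact hoff.of_subset_closure
    (hcont.comp (continuous_id.add continuous_const).continuousOn
      fun _ hu => add_omega_mem_finitePart hu)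
    (continuousOn_const.mul hcont) (offPoint_subset_finitePart Λ x₀)
    fun u _ => dense_offPoint Λ x₀ u

lemma IsHKSolution.hasCrystalMomentum_iff {ℓ : ℕ} {B : ℂ} {Φ Ψ : ℂ → ℂ}
    (h : IsHKSolution Λ ℓ B x₀ y₀ κ Ψ) (hΦ : IsPhi Λ x₀ y₀ Φ) (k : ℂ) :
    HasCrystalMomentum Λ (finitePart Λ) Ψ k ↔
      HasCrystalMomentum Λ (offPoint Λ x₀) Φ (k + I * κ) := by
  obtain ⟨k₁, hk₁⟩ := hΦ.exists_hasCrystalMomentum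
  rw [(h.hasCrystalMomentum_sub hΦ hk₁).iff_exp_eq h.2.1, hk₁.iff_exp_eq hΦ.exists_ne_zero,
    exp_mul_omega_eq_iff, exp_mul_omega_eq_iff]
  exact exists_congr fun n =>
    ⟨fun hn => by linear_combination hn, fun hn => by linear_combination hn⟩

/-- At a point where the maps have a solution, `k` is a value of `k_ℓ` exactly when `k + i κ` is a
crystal momentum of one, hence of every, branch of `Φ`. -/
lemma AnsatzMaps.mem_crystalMomentum_iff {M : AnsatzMaps} {ℓ : ℕ} {P : ℂ × ℂ} {Φ : ℂ → ℂ}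
    (hex : ∃ Ψ, M.IsSolutionAt Λ ℓ P Ψ) (hΦ : IsPhi Λ (M.proj P).1 (2 * (M.proj P).2) Φ) (k : ℂ) :
    k ∈ M.crystalMomentum Λ ℓ P ↔
      HasCrystalMomentum Λ (offPoint Λ (M.proj P).1) Φ (k + I * M.kappa P) :=
  ⟨fun ⟨_, hΨ, hk⟩ => (IsHKSolution.hasCrystalMomentum_iff hΨ hΦ k).1 hk, fun hk =>
    let ⟨Ψ, hΨ⟩ := hex
    ⟨Ψ, hΨ, (IsHKSolution.hasCrystalMomentum_iff hΨ hΦ k).2 hk⟩⟩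

end Lame

/-! ### The dispersion relation -/

theorem mainTheorem7 (Λ : PeriodPair) (ℓ : ℕ) (hℓ : 1 ≤ ℓ) (M : Lame.AnsatzMaps) (S : Set ℂ)
    (hM : M.Integrates Λ ℓ S) (B ν : ℂ) (hP : (B, ν) ∈ Lame.spectralCurve ℓ Λ.g₂ Λ.g₃)
    (hB : B ∉ S) :
    -- `k_ℓ(B, ν) = k₁(B_ℓ, ν_ℓ) - i κ̂_ℓ ν`, as multi-valued functions
    M.crystalMomentum Λ ℓ (B, ν) =
        {k | ∃ k₁ ∈ Lame.crystalMomentumOne Λ (M.proj (B, ν)),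
          k = k₁ - Complex.I * (M.kappaHat.eval (RingHom.id ℂ) B * ν)} ∧
      -- `k_ℓ(B, ν)` has a value, which is unique up to integer multiples of `π / ω`
      (∃ k, M.crystalMomentum Λ ℓ (B, ν) =
        Set.range fun n : ℤ => k + n * (2 * Real.pi / Λ.ω₁)) ∧
      -- and it is the crystal momentum of every Hermite–Krichever solution at `(B, ν)`
      (∀ Ψ, M.IsSolutionAt Λ ℓ (B, ν) Ψ → ∀ k,
        Lame.HasCrystalMomentum Λ (Lame.finitePart Λ) Ψ k ↔ k ∈ M.crystalMomentum Λ ℓ (B, ν)) ∧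
      -- the first term is the crystal momentum of the factor `Φ`, the second that of the
      -- exponential, and the factor containing the polynomials contributes nothing
      (∀ (Ψ Φ : ℂ → ℂ) (𝒜 ℬ : Polynomial ℂ) (x₀ y₀ κ : ℂ),
        x₀ = (M.proj (B, ν)).1 → y₀ = 2 * (M.proj (B, ν)).2 → κ = M.kappa (B, ν) →
        M.IsSolutionAt Λ ℓ (B, ν) Ψ → Lame.IsHKForm Λ x₀ y₀ κ 𝒜 ℬ Φ Ψ →
        (∀ u ∈ Lame.offPoint Λ x₀,
            Ψ u = Lame.hkFactor Λ x₀ y₀ 𝒜 ℬ u * Φ u * Complex.exp (κ * u)) ∧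
          Lame.HasCrystalMomentum Λ (Lame.offPoint Λ x₀) (Lame.hkFactor Λ x₀ y₀ 𝒜 ℬ) 0 ∧
          (∀ k, Lame.HasCrystalMomentum Λ (Lame.offPoint Λ x₀) Φ k ↔
            k ∈ Lame.crystalMomentumOne Λ (M.proj (B, ν))) ∧
          Lame.HasCrystalMomentum Λ Set.univ (fun u => Complex.exp (κ * u))
            (-(Complex.I * (M.kappaHat.eval (RingHom.id ℂ) B * ν)))) := by

  have hex := hM.solvable (B, ν) hP hB
  obtain ⟨Ψ₀, hΨ₀⟩ := hex
  obtain ⟨Φ₀, hΦ₀⟩ := Lame.IsHKSolution.exists_isPhi hΨ₀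
  have hmem := Lame.AnsatzMaps.mem_crystalMomentum_iff ⟨Ψ₀, hΨ₀⟩ hΦ₀
  have hone := hΦ₀.hasCrystalMomentum_iff_mem
  have hκ : M.kappa (B, ν) = M.kappaHat.eval (RingHom.id ℂ) B * ν := rfl
  refine ⟨?_, ?_, ?_, ?_⟩
  · ext k
    rw [hmem, hone, hκ]
    constructor
    · exact fun hk => ⟨_, hk, by ring⟩
    · rintro ⟨k₁, hk₁, rfl⟩
      rwa [sub_add_cancel]
  · obtain ⟨k₁, hk₁⟩ := hΦ₀.exists_hasCrystalMomentum
    refine ⟨k₁ - Complex.I * M.kappa (B, ν), ?_⟩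
    ext k
    rw [hmem, hk₁.iff_exp_eq hΦ₀.exists_ne_zero, Lame.exp_mul_omega_eq_iff]
    exact exists_congr fun n =>
      ⟨fun hn => by linear_combination hn, fun hn => by linear_combination hn⟩
  · intro Ψ hΨ k
    rw [hmem]
    exact Lame.IsHKSolution.hasCrystalMomentum_iff hΨ hΦ₀ k
  · rintro Ψ Φ 𝒜 ℬ x₀ y₀ κ rfl rfl rfl - hform
    exact ⟨fun u hu => hform.eq_hkFactor_mul hu, Lame.hasCrystalMomentum_hkFactor _ _ _ _ _ _,
      hform.1.hasCrystalMomentum_iff_mem, Lame.hasCrystalMomentum_exp Λ _⟩
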